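/- **Theorem 4.3.** Let $0<T<\infty$, $a>0$, $b<0$, $\epsilon>0$, $\gamma\ge 0$ and $\beta\in\mathbb R$. Put $D=\,]a,\infty[$, $\Omega=\,]0,\infty[$, $B=[b-\epsilon,b]$, so that $\partial\Omega=\{0\}$. Let $f\in L^2(\mathbb R)$ be real valued with $\operatorname{supp} f\subset B$, and assume that for some $\mu\in\mathbb R$ $$\liminf_{\tau\to\infty}\tau^{\mu}\left|\int_{b-\epsilon}^b e^{-\tau(b-y)}f(y)\,dy\right|>0 .$$ Let $u$ be the weak solution of $$\partial_t^2u-\partial_x^2u=0\ \text{ in } ]-\infty,a[\,\times\,]0,T[,\qquad u(x,0)=0,\ \ \partial_tu(x,0)=f(x),$$ $$-\partial_xu(a,t)-\gamma\,\partial_tu(a,t)-\beta\,u(a,t)=0,\quad 0<t<T,$$ that is, $u\in C([0,T];V)\cap C^1([0,T];H)$ with $V=H^1(]-\infty,a[)$, $H=L^2(]-\infty,a[)$, the initial conditions hold, and for all $\phi\in V$ and $t\in[0,T]$ $$\frac{d}{dt}\Big(\int_{-\infty}^a\partial_tu(x,t)\,\phi(x)\,dx+\gamma\,u(a,t)\phi(a)\Big)+\int_{-\infty}^a\partial_xu(x,t)\,\phi'(x)\,dx+\beta\,u(a,t)\phi(a)=0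 .$$ (Elements of $V$ are identified with their continuous representatives on $]-\infty,a]$.) For $\tau>0$ let $$w(x,\tau)=\int_0^Te^{-\tau t}u(x,t)\,dt,\qquad v(x,\tau)=\frac1{2\tau}\int_{-\infty}^{\infty}e^{-\tau|x-y|}f(y)\,dy,$$ $$I(\tau)=-v'(0,\tau)w(0,\tau)+w'(0,\tau)v(0,\tau),$$ where $'=d/dx$. For every $\tau>0$ these quantities, and $\int_Bf(w-v)\,dy$, are well defined: the integral defining $w(x,\tau)$ converges for each $x\le a$, $w(\cdot,\tau)$ and $v(\cdot,\tau)$ are differentiable at $0$, and $f(w-v)$ is integrable on $B$. Moreover: (i) If $T>2\,\mathrm{dist}(D,B)-\mathrm{dist}(\Omega,B)$, then, as $\tau\to\infty$, one has the complete asymptotic expansion (in the sense of Poincaré) $$\frac{e^{2\tau\,\mathrm{dist}(D,B)}\,I(\tau)}{\left|\int_{b-\epsilon}^be^{-\tau(b-y)}f(y)\,dy\right|^2}\sim-\frac{\gamma-1}{2(\gamma+1)}\frac1\tau-\frac{\beta}{(\gamma+1)^2}\sum_{n=0}^\infty\Big(-\frac{\beta}{\gamma+1}\Big)^n\frac1{\tau^{n+2}}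 .$$ (ii) If $T>2\,\mathrm{dist}(D,B)$, then, as $\tau\to\infty$, the function $$\tau\longmapsto\frac{e^{2\tau\,\mathrm{dist}(D,B)}\int_Bf(w-v)\,dy}{\left|\int_{b-\epsilon}^be^{-\tau(b-y)}f(y)\,dy\right|^2}$$ has the same complete asymptotic expansion. In both cases $\gamma$ and $\beta$ can be recovered from the normalized function, call it $F(\tau)$: the limits $c_1=\lim_{\tau\to\infty}\tau F(\tau)$ and $c_2=\lim_{\tau\to\infty}\tau^2\big(F(\tau)-c_1/\tau\big)$ exist, $1+2c_1\neq0$, and $$\gamma=\frac{1-2c_1}{1+2c_1},\qquad \beta=-(\gamma+1)^2c_2 .$$ -/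

import Mathlib

open MeasureTheory Set Filter Topology Asymptotics

noncomputable section

/-- The distance between two sets of real numbers. -/
def setDist (A B : Set ℝ) : ℝ :=
  sInf {r : ℝ | ∃ x ∈ A, ∃ y ∈ B, r = dist x y}

/-- The unknown obstacle `D = ]a, ∞[`. -/
def obstacle (a : ℝ) : Set ℝ := Ioi a

/-- The domain `Ω = ]0, ∞[`, at whose boundary point `0` the wave is observed. -/
def domainOmega : Set ℝ := Ioi 0

/-- The interval `B = [b - ε, b]`, which carries the initial data. -/
def sourceB (b ε : ℝ) : Set ℝ := Icc (b - ε) b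

/-- Lebesgue measure on the half-line `]-∞, a[`. -/
abbrev halfLineMeasure (a : ℝ) : Measure ℝ := volume.restrict (Iio a)

/-- The real space `L²(]-∞, a[)`. -/
abbrev L2HalfLine (a : ℝ) : Type := Lp ℝ 2 (halfLineMeasure a)

/-- `g` is the representative, (absolutely) continuous up to the boundary point `a`, of an element
of the Sobolev space `V = H¹(]-∞, a[)`, and `g'` is its weak derivative. In particular `g a` is
the boundary trace of this element. -/
structure IsH1HalfLine (a : ℝ) (g g' : ℝ → ℝ) : Prop where
  memLp : MemLp g 2 (halfLineMeasure a)
  memLp_deriv : MemLp g' 2 (halfLineMeasure a)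
  sub_eq_integral : ∀ x ≤ a, ∀ y ≤ a, g y - g x = ∫ z in x..y, g' z

/-- `u` (as a function of `x` and `t`) is a weak solution of
`∂ₜ²u - ∂ₓ²u = 0` in `]-∞, a[ × ]0, T[`, `u(x, 0) = 0`, `∂ₜu(x, 0) = f(x)`,
`-∂ₓu(a, t) - γ ∂ₜu(a, t) - β u(a, t) = 0` for `0 < t < T`.
It is of finite energy, that is, in `C([0, T]; V) ∩ C¹([0, T]; L²)`, and for every `φ ∈ V` and
`t ∈ [0, T]`
`d/dt ((∂ₜu(t), φ) + γ u(a, t) φ(a)) + (∂ₓu(t), φ') + β u(a, t) φ(a) = 0`.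
The curves `U`, `Ux`, `Ut` are `u`, `∂ₓu`, `∂ₜu` as curves in `L²(]-∞, a[)`. -/
def IsWeakSolution (a T γ β : ℝ) (f : ℝ → ℝ) (u : ℝ → ℝ → ℝ) : Prop :=
  ∃ U Ux Ut : ℝ → L2HalfLine a,
    (∀ t ∈ Icc 0 T, U t =ᵐ[halfLineMeasure a] fun x => u x t) ∧
    (∀ t ∈ Icc 0 T, IsH1HalfLine a (fun x => u x t) (Ux t)) ∧
    ContinuousOn U (Icc 0 T) ∧
    ContinuousOn Ux (Icc 0 T) ∧
    ContinuousOn Ut (Icc 0 T) ∧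
    (∀ t ∈ Icc 0 T, HasDerivWithinAt U (Ut t) (Icc 0 T) t) ∧
    (∀ x ≤ a, u x 0 = 0) ∧
    Ut 0 =ᵐ[halfLineMeasure a] f ∧
    ∀ φ φ' : ℝ → ℝ, IsH1HalfLine a φ φ' → ∀ t ∈ Icc 0 T,
      HasDerivWithinAt (fun s => (∫ x in Iio a, Ut s x * φ x) + γ * u a s * φ a)
        (-((∫ x in Iio a, Ux t x * φ' x) + β * u a t * φ a)) (Icc 0 T) t

/-- `w(x, τ) = ∫₀ᵀ e^{-τ t} u(x, t) dt`. -/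
def waveLaplace (T : ℝ) (u : ℝ → ℝ → ℝ) (x τ : ℝ) : ℝ :=
  ∫ t in (0 : ℝ)..T, Real.exp (-τ * t) * u x t

/-- `v(x, τ) = (1 / (2τ)) ∫ e^{-τ |x - y|} f(y) dy`. -/
def freeField (f : ℝ → ℝ) (x τ : ℝ) : ℝ :=
  1 / (2 * τ) * ∫ y, Real.exp (-τ * |x - y|) * f y

/-- The indicator function `I(τ) = -v'(0, τ) w(0, τ) + w'(0, τ) v(0, τ)`. -/
def indicatorI (T : ℝ) (f : ℝ → ℝ) (u : ℝ → ℝ → ℝ) (τ : ℝ) : ℝ :=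
  -deriv (fun x => freeField f x τ) 0 * waveLaplace T u 0 τ +
    deriv (fun x => waveLaplace T u x τ) 0 * freeField f 0 τ

/-- The back-scattering quantity `∫_B f (w - v) dy`. -/
def backScattering (b ε T : ℝ) (f : ℝ → ℝ) (u : ℝ → ℝ → ℝ) (τ : ℝ) : ℝ :=
  ∫ y in sourceB b ε, f y * (waveLaplace T u y τ - freeField f y τ)

/-- `∫_{b-ε}^b e^{-τ (b - y)} f(y) dy`. -/
def sourceIntegral (b ε : ℝ) (f : ℝ → ℝ) (τ : ℝ) : ℝ :=
  ∫ y in (b - ε)..b, Real.exp (-τ * (b - y)) * f y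

/-- `liminf_{τ → ∞} τ^μ |∫_{b-ε}^b e^{-τ (b - y)} f(y) dy| > 0` for some real `μ`. The lower limit
is taken in `[0, ∞]`. -/
def NonvanishingAtEndpoint (b ε : ℝ) (f : ℝ → ℝ) : Prop :=
  ∃ μ : ℝ, 0 < liminf (fun τ : ℝ => ENNReal.ofReal (τ ^ μ * |sourceIntegral b ε f τ|)) atTop

/-- A function `J` of `τ`, multiplied by `e^{2τ dist(D, B)}` and divided by
`|∫_{b-ε}^b e^{-τ (b - y)} f(y) dy|²`. -/
def normalized (a b ε : ℝ) (f : ℝ → ℝ) (J : ℝ → ℝ) (τ : ℝ) : ℝ :=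
  Real.exp (2 * τ * setDist (obstacle a) (sourceB b ε)) * J τ / |sourceIntegral b ε f τ| ^ 2

/-- Complete asymptotic expansion `F(τ) ∼ ∑ k, c k / τ ^ k` as `τ → ∞`, in the sense of
Poincaré. -/
def HasAsymptoticExpansion (F : ℝ → ℝ) (c : ℕ → ℝ) : Prop :=
  ∀ N : ℕ, (fun τ => F τ - ∑ k ∈ Finset.range N, c k / τ ^ k) =O[atTop] fun τ => 1 / τ ^ N

/-- The coefficients of
`-(γ - 1) / (2 (γ + 1)) τ⁻¹ - β / (γ + 1)² ∑ n, (-β / (γ + 1)) ^ n τ ^ (-n - 2)`. -/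
def expansionCoeff (γ β : ℝ) : ℕ → ℝ
  | 0 => 0
  | 1 => -((γ - 1) / (2 * (γ + 1)))
  | n + 2 => -(β / (γ + 1) ^ 2) * (-β / (γ + 1)) ^ n

/-- The numbers `γ` and `β` are recovered from the behaviour of `F` at infinity: the limits
`c₁ = lim τ F(τ)` and `c₂ = lim τ² (F(τ) - c₁ / τ)` exist, and they give first `γ`, then `β`. -/
def RecoversParameters (F : ℝ → ℝ) (γ β : ℝ) : Prop :=
  ∃ c₁ c₂ : ℝ, Tendsto (fun τ => τ * F τ) atTop (𝓝 c₁) ∧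
    Tendsto (fun τ => τ ^ 2 * (F τ - c₁ / τ)) atTop (𝓝 c₂) ∧
    1 + 2 * c₁ ≠ 0 ∧ γ = (1 - 2 * c₁) / (1 + 2 * c₁) ∧ β = -(γ + 1) ^ 2 * c₂

end

/-! The kernel `φ(y) = e^{-τ|x-y|}` is an admissible test function, and it satisfies `(g', φ') +
τ²(g, φ) = 2τ g(x) - τ φ(a) g(a)` for every `g` in `H¹(]-∞, a[)`
(`IsH1HalfLine.integral_deriv_mul_add`). Testing the weak equation with it and integrating against
`e^{-τt}` over `[0, T]` gives an exact formula for `w(x)`: the free field, plus an echo proportional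
to `e^{-τ(a-x)}`, plus terms with factor `e^{-τT}` coming from the state at time `T`
(`IsWeakSolution.exists_waveLaplace_eq`). Only the energy regularity of `u` is used, and no explicit
solution.

At `x = a` the formula is a linear equation for `w(a)`. Solving it shows that the echo has amplitude
`R(τ) e^{-τ(a-b)} S(τ)` up to `e^{-τT}`, where `S` is the source integral and `R =
((1-γ)τ-β)/((1+γ)τ+β)` (`echo_eq`). Inserted in `I` and in the back-scattering integral, the echo
contributes `R S² e^{-2τ(a-b)}/(2τ)`. The other terms have an additional exponentially small factor
exactly under the stated bounds on `T`, and since `1/S` grows at most polynomially they do not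
affect the expansion.

It remains to expand `R/(2τ)`, a geometric series in `-β/((1+γ)τ)` with an explicit remainder
(`reflectionCoeff_sub_sum`), whose first two coefficients determine `γ` and then `β`. -/

/-! ### The exponential kernel and its potentials. -/

/-- The decaying exponential `e^{-τ |x - y|}`, which is `2τ` times the free-space Green function
of `τ² - ∂²`. -/
noncomputable def expKernel (τ x y : ℝ) : ℝ := Real.exp (-τ * |x - y|)

/-- The derivative of `expKernel τ x y` with respect to `y`. -/
noncomputable def expKernelDeriv (τ x y : ℝ) : ℝ := (if y < x then τ else -τ) * expKernel τ x y

lemma continuous_expKernel (τ x : ℝ) : Continuous (expKernel τ x) := by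
  unfold expKernel; fun_prop

lemma expKernel_pos (τ x y : ℝ) : 0 < expKernel τ x y := Real.exp_pos _

lemma expKernel_of_le {τ x y : ℝ} (h : y ≤ x) : expKernel τ x y = Real.exp (-τ * (x - y)) := by
  rw [expKernel, abs_of_nonneg (by linarith)]

lemma expKernel_of_ge {τ x y : ℝ} (h : x ≤ y) : expKernel τ x y = Real.exp (-τ * (y - x)) := by
  rw [expKernel, abs_of_nonpos (by linarith), neg_sub]

lemma measurable_expKernelDeriv (τ x : ℝ) : Measurable (expKernelDeriv τ x) := by
  unfold expKernelDeriv
  exact (Measurable.ite measurableSet_Iio measurable_const measurable_const).mul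
    (continuous_expKernel τ x).measurable

lemma abs_expKernelDeriv {τ : ℝ} (hτ : 0 ≤ τ) (x y : ℝ) :
    |expKernelDeriv τ x y| = τ * expKernel τ x y := by
  rw [expKernelDeriv, abs_mul, abs_of_pos (expKernel_pos τ x y)]
  split_ifs <;> simp [abs_of_nonneg hτ]

lemma hasDerivAt_expKernel {τ x y : ℝ} (h : y ≠ x) :
    HasDerivAt (expKernel τ x) (expKernelDeriv τ x y) y := by
  rcases lt_or_gt_of_ne h with h | h
  · have h1 : HasDerivAt (fun y => Real.exp (-τ * (x - y)))
        (Real.exp (-τ * (x - y)) * (-τ * (0 - 1))) y :=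
      (((hasDerivAt_const y x).sub (hasDerivAt_id y)).const_mul (-τ)).exp
    have h2 : expKernel τ x =ᶠ[𝓝 y] fun y => Real.exp (-τ * (x - y)) := by
      filter_upwards [Iio_mem_nhds h] with z hz using expKernel_of_le (le_of_lt hz)
    refine (h1.congr_of_eventuallyEq h2).congr_deriv ?_
    rw [expKernelDeriv, if_pos h, expKernel_of_le h.le]; ring
  · have h1 : HasDerivAt (fun y => Real.exp (-τ * (y - x)))
        (Real.exp (-τ * (y - x)) * (-τ * (1 - 0))) y :=
      (((hasDerivAt_id y).sub (hasDerivAt_const y x)).const_mul (-τ)).exp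
    have h2 : expKernel τ x =ᶠ[𝓝 y] fun y => Real.exp (-τ * (y - x)) := by
      filter_upwards [Ioi_mem_nhds h] with z hz using expKernel_of_ge (le_of_lt hz)
    refine (h1.congr_of_eventuallyEq h2).congr_deriv ?_
    rw [expKernelDeriv, if_neg (not_lt.2 (le_of_lt h)), expKernel_of_ge (le_of_lt h)]; ring

lemma integrable_expKernel {τ : ℝ} (hτ : 0 < τ) (x : ℝ) : Integrable (expKernel τ x) := by
  rw [← integrableOn_univ, ← Iic_union_Ioi (a := x)]
  refine IntegrableOn.union ?_ ?_
  · refine IntegrableOn.congr_fun (f := fun y => Real.exp (-τ * x) * Real.exp (τ * y))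
      ((integrableOn_exp_mul_Iic hτ x).const_mul _) (fun y hy => ?_) measurableSet_Iic
    dsimp only
    rw [expKernel_of_le hy, ← Real.exp_add]; ring_nf
  · refine IntegrableOn.congr_fun (f := fun y => Real.exp (τ * x) * Real.exp (-τ * y))
      ((integrableOn_exp_mul_Ioi (neg_lt_zero.2 hτ) x).const_mul _) (fun y hy => ?_)
      measurableSet_Ioi
    dsimp only
    rw [expKernel_of_ge (le_of_lt hy), ← Real.exp_add]; ring_nf

lemma memLp_expKernel {τ : ℝ} (hτ : 0 < τ) (x : ℝ) : MemLp (expKernel τ x) 2 volume := by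
  rw [memLp_two_iff_integrable_sq (continuous_expKernel τ x).aestronglyMeasurable]
  refine (integrable_expKernel (show 0 < 2 * τ by linarith) x).congr (.of_forall fun y => ?_)
  simp only [expKernel, ← Real.exp_nat_mul]
  push_cast; ring_nf

lemma memLp_expKernelDeriv {τ : ℝ} (hτ : 0 < τ) (x : ℝ) :
    MemLp (expKernelDeriv τ x) 2 volume := by
  refine ((memLp_expKernel hτ x).const_mul τ).mono
    (measurable_expKernelDeriv τ x).aestronglyMeasurable (.of_forall fun y => ?_)
  rw [Real.norm_eq_abs, Real.norm_eq_abs, abs_expKernelDeriv hτ.le,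
    abs_of_pos (mul_pos hτ (expKernel_pos τ x y))]

/-- This makes the kernel a legitimate test function; its kink at `x` is a single exceptional point,
harmless for the fundamental theorem of calculus. -/
lemma isH1HalfLine_expKernel {τ : ℝ} (hτ : 0 < τ) (a x : ℝ) :
    IsH1HalfLine a (expKernel τ x) (expKernelDeriv τ x) where
  memLp := (memLp_expKernel hτ x).restrict _
  memLp_deriv := (memLp_expKernelDeriv hτ x).restrict _
  sub_eq_integral p _ q _ := by
    refine (integral_eq_of_hasDerivAt_off_countable (s := {x}) _ _ (countable_singleton x)
      (continuous_expKernel τ x).continuousOn (fun y hy => hasDerivAt_expKernel hy.2) ?_).symm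
    exact intervalIntegrable_iff.2
      (((memLp_expKernelDeriv hτ x).locallyIntegrable (by norm_num)).integrableOn_isCompact
        isCompact_uIcc |>.mono_set uIoc_subset_uIcc)

lemma integrable_mul_expKernel {τ : ℝ} (hτ : 0 < τ) (x : ℝ) {P : ℝ → ℝ} {s : Set ℝ}
    (hP : MemLp P 2 (volume.restrict s)) :
    Integrable (fun y => P y * expKernel τ x y) (volume.restrict s) :=
  hP.integrable_mul ((memLp_expKernel hτ x).restrict s)

lemma integrable_mul_expKernelDeriv {τ : ℝ} (hτ : 0 < τ) (x : ℝ) {P : ℝ → ℝ} {s : Set ℝ}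
    (hP : MemLp P 2 (volume.restrict s)) :
    Integrable (fun y => P y * expKernelDeriv τ x y) (volume.restrict s) :=
  hP.integrable_mul ((memLp_expKernelDeriv hτ x).restrict s)

/-- By the triangle inequality, moving the centre by at most `r` costs a factor `e^{τr}`. This
supplies majorants that are locally uniform in the centre. -/
lemma expKernel_le_mul {τ : ℝ} (hτ : 0 ≤ τ) {x x₀ r : ℝ} (h : |x - x₀| ≤ r) (y : ℝ) :
    expKernel τ x y ≤ Real.exp (τ * r) * expKernel τ x₀ y := by
  rw [expKernel, expKernel, ← Real.exp_add]
  have : |x₀ - y| ≤ |x - x₀| + |x - y| := by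
    rw [abs_sub_comm x x₀]; exact abs_sub_le _ _ _
  exact Real.exp_le_exp.2 (by nlinarith)

/-- The Laplace potential of an `L²` density is differentiable everywhere. -/
lemma hasDerivAt_integral_mul_expKernel {τ : ℝ} (hτ : 0 < τ) (x₀ : ℝ) {P : ℝ → ℝ} {s : Set ℝ}
    (hP : MemLp P 2 (volume.restrict s)) :
    HasDerivAt (fun x => ∫ y in s, P y * expKernel τ x y)
      (∫ y in s, -(P y * expKernelDeriv τ x₀ y)) x₀ := by
  have hsymm : ∀ x y, expKernel τ x y = expKernel τ y x := fun x y => by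
    rw [expKernel, expKernel, abs_sub_comm]
  -- The integrand is not differentiable in `x` at `x = y`, so the Lipschitz form of differentiation
  -- under the integral is used: it asks for differentiability at `x₀` only for almost every `y`.
  -- The factor `e^τ` in the bound comes from the radius `1` of the neighbourhood.
  refine (hasDerivAt_integral_of_dominated_loc_of_lip (𝕜 := ℝ) (μ := volume.restrict s)
    (F := fun x y => P y * expKernel τ x y) (s := Ioo (x₀ - 1) (x₀ + 1))
    (bound := fun y => |P y| * (τ * (Real.exp (τ * 1) * expKernel τ x₀ y)))
    (Ioo_mem_nhds (by linarith) (by linarith)) ?_ ?_ ?_ ?_ ?_ ?_).2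
  · exact .of_forall fun x => (integrable_mul_expKernel hτ x hP).aestronglyMeasurable
  · exact integrable_mul_expKernel hτ x₀ hP
  · exact (integrable_mul_expKernelDeriv hτ x₀ hP).neg.aestronglyMeasurable
  · refine .of_forall fun y => ?_
    refine LipschitzOnWith.of_dist_le_mul fun p hp q hq => ?_
    have key : ∀ p ∈ Ioo (x₀ - 1) (x₀ + 1), ∀ q ∈ Ioo (x₀ - 1) (x₀ + 1),
        expKernel τ p y - expKernel τ q y ≤ Real.exp (τ * 1) * expKernel τ x₀ y * (τ * |p - q|) := by
      intro p hp q hq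
      have h1 := expKernel_le_mul hτ.le (x := p) (x₀ := x₀) (r := 1)
        (abs_le.2 ⟨by linarith [hp.1], by linarith [hp.2]⟩) y
      have h2 : |q - y| ≤ |p - q| + |p - y| := by
        rw [abs_sub_comm p q]; exact abs_sub_le _ _ _
      have h3 : expKernel τ p y * (1 - τ * |p - q|) ≤ expKernel τ q y := by
        calc _ ≤ expKernel τ p y * Real.exp (-(τ * |p - q|)) :=
              mul_le_mul_of_nonneg_left (Real.one_sub_le_exp_neg _) (expKernel_pos _ _ _).le
          _ ≤ _ := by
              rw [expKernel, expKernel, ← Real.exp_add]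
              exact Real.exp_le_exp.2 (by nlinarith)
      have h4 := mul_le_mul_of_nonneg_right h1 (show 0 ≤ τ * |p - q| by positivity)
      linarith
    have hb : 0 ≤ |P y| * (τ * (Real.exp (τ * 1) * expKernel τ x₀ y)) := by
      have := expKernel_pos τ x₀ y
      positivity
    rw [Real.coe_nnabs, abs_of_nonneg hb, Real.dist_eq, Real.dist_eq, ← mul_sub, abs_mul]
    have h1 := key p hp q hq
    have h2 := key q hq p hp
    rw [abs_sub_comm q p] at h2
    have h3 : |expKernel τ p y - expKernel τ q y| ≤
        Real.exp (τ * 1) * expKernel τ x₀ y * (τ * |p - q|) := abs_le.2 ⟨by linarith, h1⟩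
    calc _ ≤ |P y| * (Real.exp (τ * 1) * expKernel τ x₀ y * (τ * |p - q|)) :=
          mul_le_mul_of_nonneg_left h3 (abs_nonneg _)
      _ = _ := by ring
  · have := (integrable_mul_expKernel hτ x₀ hP.abs).const_mul (τ * Real.exp (τ * 1))
    refine this.congr (.of_forall fun y => ?_)
    simp only [Pi.abs_apply]; ring
  · have : ∀ᵐ y ∂(volume.restrict s), y ≠ x₀ :=
      ae_restrict_of_ae (by simp [ae_iff, measure_singleton])
    filter_upwards [this] with y hy
    have h1 := (hasDerivAt_expKernel (τ := τ) hy.symm).const_mul (P y)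
    refine (h1.congr_of_eventuallyEq (.of_forall fun x => by rw [hsymm])).congr_deriv ?_
    · rw [expKernelDeriv, expKernelDeriv, hsymm]
      rcases lt_or_gt_of_ne hy with h | h
      · rw [if_pos h, if_neg (not_lt.2 h.le)]; ring
      · rw [if_pos h, if_neg (not_lt.2 (le_of_lt h))]; ring

/-! ### Trace and reproducing identities for `H¹` functions on the half-line. -/

/-- Integration by parts against an exponential for a primitive. -/
lemma integral_deriv_add_mul_exp {g g' : ℝ → ℝ} {p q : ℝ} (k : ℝ)
    (hint : IntervalIntegrable g' volume p q)
    (hg : ∀ y ∈ uIcc p q, g y - g p = ∫ z in p..y, g' z) :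
    ∫ y in p..q, (g' y + k * g y) * Real.exp (k * y) =
      g q * Real.exp (k * q) - g p * Real.exp (k * p) := by
  have hexp : ∀ y, HasDerivAt (fun y => Real.exp (k * y)) (k * Real.exp (k * y)) y := fun y => by
    simpa [mul_comm] using ((hasDerivAt_id y).const_mul k).exp
  -- As `g'` is merely integrable, the product rule for absolutely continuous functions is applied
  -- to the primitive vanishing at `p`; the constant `g p` is treated separately in `h2`.
  have hF := hint.absolutelyContinuousOnInterval_intervalIntegral (c := p) (by simp)
  have hE : AbsolutelyContinuousOnInterval (fun y => Real.exp (k * y)) p q :=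
    ContDiffOn.absolutelyContinuousOnInterval (by fun_prop)
  have h1 := hF.integral_deriv_mul_eq_sub hE
  have h2 : ∫ y in p..q, g p * (k * Real.exp (k * y)) =
      g p * (Real.exp (k * q) - Real.exp (k * p)) := by
    rw [intervalIntegral.integral_const_mul,
      intervalIntegral.integral_eq_sub_of_hasDerivAt (fun y _ => hexp y)
        (by apply Continuous.intervalIntegrable; fun_prop)]
  have hi1 : IntervalIntegrable (fun y => deriv (fun x => ∫ v in p..x, g' v) y * Real.exp (k * y) +
      (∫ v in p..y, g' v) * deriv (fun y => Real.exp (k * y)) y) volume p q :=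
    (hF.intervalIntegrable_deriv.mul_continuousOn hE.continuousOn).add
      (hE.intervalIntegrable_deriv.continuousOn_mul hF.continuousOn)
  have h3 : ∫ y in p..q, (g' y + k * g y) * Real.exp (k * y) =
      ∫ y in p..q, ((deriv (fun x => ∫ v in p..x, g' v) y * Real.exp (k * y) +
      (∫ v in p..y, g' v) * deriv (fun y => Real.exp (k * y)) y) +
        g p * (k * Real.exp (k * y))) := by
    apply intervalIntegral.integral_congr_ae
    filter_upwards [hint.ae_hasDerivAt_integral] with y hy hyu
    have hyu' := uIoc_subset_uIcc hyu
    rw [(hy hyu' p (by simp)).deriv, (hexp y).deriv, ← hg y hyu']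
    ring
  rw [h3, intervalIntegral.integral_add hi1 (by apply Continuous.intervalIntegrable; fun_prop), h1,
    h2, ← hg q (by simp)]
  simp
  ring

lemma MemLp.mono_halfLine {a x : ℝ} (hx : x ≤ a) {g : ℝ → ℝ} (hg : MemLp g 2 (halfLineMeasure a)) :
    MemLp g 2 (halfLineMeasure x) :=
  hg.mono_measure (Measure.restrict_mono (Iio_subset_Iio hx) le_rfl)

lemma MemLp.intervalIntegrable_halfLine {a p q : ℝ} (hp : p ≤ a) (hq : q ≤ a) {g : ℝ → ℝ}
    (hg : MemLp g 2 (halfLineMeasure a)) : IntervalIntegrable g volume p q := by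
  rw [halfLineMeasure, restrict_Iio_eq_restrict_Iic] at hg
  have h1 : MemLp g 2 (volume.restrict (uIoc p q)) :=
    hg.mono_measure (Measure.restrict_mono (fun y hy => by
      rcases le_total p q with h | h
      · rw [uIoc_of_le h] at hy; exact hy.2.trans hq
      · rw [uIoc_of_ge h] at hy; exact hy.2.trans hp) le_rfl)
  have : IsFiniteMeasure (volume.restrict (uIoc p q)) := ⟨by
    simp [uIoc]⟩
  exact intervalIntegrable_iff.2 (h1.integrable (by norm_num))

namespace IsH1HalfLine

variable {a τ x : ℝ} {g g' : ℝ → ℝ}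

lemma integral_deriv_add_mul_exp (h : IsH1HalfLine a g g') (k : ℝ) {p q : ℝ} (hp : p ≤ a)
    (hq : q ≤ a) : ∫ y in p..q, (g' y + k * g y) * Real.exp (k * y) =
      g q * Real.exp (k * q) - g p * Real.exp (k * p) :=
  _root_.integral_deriv_add_mul_exp k (MemLp.intervalIntegrable_halfLine hp hq h.memLp_deriv)
    fun y hy => h.sub_eq_integral p hp y (by
      rcases le_total p q with h | h
      · rw [uIcc_of_le h] at hy; exact hy.2.trans hq
      · rw [uIcc_of_ge h] at hy; exact hy.2.trans hp)

/-- The trace at `x` of an `H¹` function as an integral over `]-∞, x[`. -/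
lemma integral_Iio_mul_expKernel (h : IsH1HalfLine a g g') (hτ : 0 < τ) (hx : x ≤ a) :
    ∫ y in Iio x, (g' y + τ * g y) * expKernel τ x y = g x := by
  have hmul : ∀ G : ℝ → ℝ, EqOn (fun y => Real.exp (τ * x) * (G y * expKernel τ x y))
      (fun y => G y * Real.exp (τ * y)) (Iic x) := fun G y hy => by
    dsimp only
    rw [expKernel_of_le hy, mul_left_comm, ← Real.exp_add]; ring_nf
  have hint : ∀ {G : ℝ → ℝ}, MemLp G 2 (halfLineMeasure a) →
      IntegrableOn (fun y => G y * Real.exp (τ * y)) (Iic x) := fun {G} hG => by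
    have h1 : IntegrableOn (fun y => Real.exp (τ * x) * (G y * expKernel τ x y)) (Iio x) :=
      (integrable_mul_expKernel hτ x (MemLp.mono_halfLine hx hG)).const_mul _
    rw [IntegrableOn, restrict_Iio_eq_restrict_Iic] at h1
    exact IntegrableOn.congr_fun h1 (hmul G) measurableSet_Iic
  have hG : MemLp (fun y => g' y + τ * g y) 2 (halfLineMeasure a) :=
    h.memLp_deriv.add (h.memLp.const_mul τ)
  have hlim := intervalIntegral_tendsto_integral_Iic x (hint hG) tendsto_id
  have hlim' : Tendsto (fun p => g p * Real.exp (τ * p)) atBot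
      (𝓝 (g x * Real.exp (τ * x) - ∫ y in Iic x, (g' y + τ * g y) * Real.exp (τ * y))) := by
    refine (hlim.const_sub _).congr' ?_
    filter_upwards [eventually_le_atBot x] with p hp
    rw [id, h.integral_deriv_add_mul_exp τ (hp.trans hx) hx]; ring
  -- The boundary term at `-∞` has a limit, and it is integrable on a half-line of infinite measure,
  -- so the limit is zero.
  have hzero := IntegrableAtFilter.eq_zero_of_tendsto (μ := volume)
    ⟨Iic x, Iic_mem_atBot x, hint h.memLp⟩ (fun s hs => by
      obtain ⟨r, hr⟩ := mem_atBot_sets.1 hs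
      exact measure_mono_top (s₁ := Iic r) (fun y hy => hr y hy) Real.volume_Iic) hlim'
  rw [restrict_Iio_eq_restrict_Iic]
  have h2 := setIntegral_congr_fun measurableSet_Iic (hmul fun y => g' y + τ * g y) (μ := volume)
  rw [integral_const_mul] at h2
  have := Real.exp_pos (τ * x)
  refine mul_left_cancel₀ this.ne' ?_
  rw [h2]
  linarith

lemma integral_mul_expKernel_right (h : IsH1HalfLine a g g') (hx : x ≤ a) :
    ∫ y in x..a, (-g' y + τ * g y) * expKernel τ x y = g x - g a * expKernel τ x a := by
  have h1 := h.integral_deriv_add_mul_exp (-τ) hx le_rfl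
  have h2 : ∫ y in x..a, (-g' y + τ * g y) * expKernel τ x y =
      ∫ y in x..a, -Real.exp (τ * x) * ((g' y + -τ * g y) * Real.exp (-τ * y)) := by
    refine intervalIntegral.integral_congr fun y hy => ?_
    rw [uIcc_of_le hx] at hy
    rw [expKernel_of_ge hy.1, show -τ * (y - x) = τ * x + -τ * y by ring, Real.exp_add]; ring
  rw [h2, intervalIntegral.integral_const_mul, h1, expKernel_of_ge hx,
    show -τ * (a - x) = τ * x + -τ * a by ring, Real.exp_add]
  have : Real.exp (τ * x) * Real.exp (-τ * x) = 1 := by rw [← Real.exp_add]; simp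
  linear_combination (g x) * this

/-- The exponential kernel reproduces `H¹` functions, up to a boundary term. -/
lemma integral_deriv_mul_add (h : IsH1HalfLine a g g') (hτ : 0 < τ) (hx : x ≤ a) :
    (∫ y in Iio a, g' y * expKernelDeriv τ x y) + τ ^ 2 * ∫ y in Iio a, g y * expKernel τ x y =
      2 * τ * g x - τ * expKernel τ x a * g a := by
  have hi1 := integrable_mul_expKernelDeriv hτ x h.memLp_deriv
  have hi2 := (integrable_mul_expKernel hτ x h.memLp).const_mul (τ ^ 2)
  have hi := hi1.add hi2
  rw [← integral_const_mul, ← integral_add hi1 hi2]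
  have hi' : IntegrableOn (fun y => g' y * expKernelDeriv τ x y + τ ^ 2 * (g y * expKernel τ x y))
    (Iio a) := hi
  have hdisj : Disjoint (Iio x) (Ico x a) :=
    Set.disjoint_left.2 fun y hy hy' => (not_lt.2 hy'.1) hy
  rw [← Iio_union_Ico_eq_Iio hx, setIntegral_union hdisj measurableSet_Ico
    (hi'.mono_set (Iio_subset_Iio hx)) (hi'.mono_set Ico_subset_Iio_self)]
  have e1 : ∫ y in Iio x, (g' y * expKernelDeriv τ x y + τ ^ 2 * (g y * expKernel τ x y)) =
      τ * ∫ y in Iio x, (g' y + τ * g y) * expKernel τ x y := by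
    rw [← integral_const_mul]
    refine setIntegral_congr_fun measurableSet_Iio fun y hy => ?_
    rw [expKernelDeriv, if_pos (mem_Iio.1 hy)]; ring
  have e2 : ∫ y in Ico x a, (g' y * expKernelDeriv τ x y + τ ^ 2 * (g y * expKernel τ x y)) =
      τ * ∫ y in x..a, (-g' y + τ * g y) * expKernel τ x y := by
    rw [intervalIntegral.integral_of_le hx, ← setIntegral_congr_set Ico_ae_eq_Ioc,
      ← integral_const_mul]
    refine setIntegral_congr_fun measurableSet_Ico fun y hy => ?_
    rw [expKernelDeriv, if_neg (not_lt.2 hy.1)]; ring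
  rw [e1, e2, h.integral_Iio_mul_expKernel hτ hx, h.integral_mul_expKernel_right hx]
  ring

end IsH1HalfLine

/-! ### The Laplace transform in time of a weak solution. -/

/-- Testing `L²` curves against a fixed `L²` function, as a continuous linear functional. -/
lemma exists_clm_integral_mul {a : ℝ} {φ : ℝ → ℝ} (hφ : MemLp φ 2 (halfLineMeasure a)) :
    ∃ L : L2HalfLine a →L[ℝ] ℝ, ∀ P : L2HalfLine a, L P = ∫ y in Iio a, P y * φ y := by
  refine ⟨innerSL ℝ (hφ.toLp φ), fun P => ?_⟩
  rw [innerSL_apply_apply, L2.inner_def]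
  refine integral_congr_ae ?_
  filter_upwards [hφ.coeFn_toLp] with y hy
  simp [hy]

section WeakSolution

variable {a T γ β : ℝ} {f : ℝ → ℝ} {u : ℝ → ℝ → ℝ} {U Ux : ℝ → L2HalfLine a}

/-- The trace identity with `τ = 1` writes `u(x, t)` as a fixed continuous linear functional of
`∂ₓu(t) + u(t)`, so continuity in `t` is inherited from the `L²` curves. The indicator of `]-∞, x[`
makes it a functional on all of `L²(]-∞, a[)`. -/
lemma continuousOn_trace (hU : ∀ t ∈ Icc 0 T, U t =ᵐ[halfLineMeasure a] fun x => u x t)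
    (hH : ∀ t ∈ Icc 0 T, IsH1HalfLine a (fun x => u x t) (Ux t))
    (hUc : ContinuousOn U (Icc 0 T)) (hUxc : ContinuousOn Ux (Icc 0 T)) {x : ℝ} (hx : x ≤ a) :
    ContinuousOn (fun t => u x t) (Icc 0 T) := by
  obtain ⟨L, hL⟩ := exists_clm_integral_mul (a := a)
    (((memLp_expKernel one_pos x).indicator measurableSet_Iio).restrict (Iio a) :
      MemLp ((Iio x).indicator (expKernel 1 x)) 2 _)
  refine ((L.continuous.comp_continuousOn (hUxc.add hUc))).congr fun t ht => ?_
  have h1 := (hH t ht).integral_Iio_mul_expKernel one_pos hx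
  rw [← h1, Function.comp_apply, hL]
  have hsub : Iio a ∩ Iio x = Iio x := inter_eq_right.2 (Iio_subset_Iio hx)
  conv_lhs => rw [← hsub]
  rw [← setIntegral_indicator measurableSet_Iio]
  refine integral_congr_ae ?_
  filter_upwards [hU t ht, Lp.coeFn_add (Ux t) (U t)] with y hy hy'
  rw [Pi.add_apply, hy', Pi.add_apply, hy]
  by_cases hyx : y ∈ Iio x <;> simp [hyx]

/-- The Laplace transform on `[0, T]` of a weak solution solves the stationary problem up to terms
carrying the factor `e^{-τ T}`; here it is expressed by means of the free-space Green function. -/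
lemma IsWeakSolution.exists_waveLaplace_eq (hu : IsWeakSolution a T γ β f u) (hT : 0 < T) :
    (∀ x ≤ a, ContinuousOn (fun t => u x t) (Icc 0 T)) ∧
    ∃ p q : ℝ → ℝ, MemLp p 2 (halfLineMeasure a) ∧ MemLp q 2 (halfLineMeasure a) ∧
      ∀ τ : ℝ, 0 < τ → ∀ x ≤ a, 2 * τ * waveLaplace T u x τ =
        (∫ y in Iio a, f y * expKernel τ x y) -
          Real.exp (-τ * T) * ((∫ y in Iio a, (p y + τ * q y) * expKernel τ x y) +
            γ * u a T * expKernel τ x a) +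
          (τ - γ * τ - β) * expKernel τ x a * waveLaplace T u a τ := by
  obtain ⟨U, Ux, Ut, hU, hH, hUc, hUxc, -, hUd, hu0, hUt0, hweak⟩ := hu
  have hcont : ∀ x ≤ a, ContinuousOn (fun t => u x t) (Icc 0 T) :=
    fun x hx => continuousOn_trace hU hH hUc hUxc hx
  refine ⟨hcont, Ut T, U T, Lp.memLp _, Lp.memLp _, fun τ hτ x hx => ?_⟩
  have h0 : (0 : ℝ) ∈ Icc 0 T := ⟨le_rfl, hT.le⟩
  have h1 : T ∈ Icc 0 T := ⟨hT.le, le_rfl⟩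
  have hK := isH1HalfLine_expKernel hτ a x
  obtain ⟨L, hL⟩ := exists_clm_integral_mul hK.memLp
  -- The added `τ(u, φ)` cancels the term `-τ(∂ₜu, φ)` produced by differentiating `e^{-τt}` and
  -- leaves `-τ²(u, φ)`, just what the reproducing identity needs.
  set N : ℝ → ℝ := fun t => Real.exp (-τ * t) *
    (((∫ y in Iio a, Ut t y * expKernel τ x y) + γ * u a t * expKernel τ x a) + τ * L (U t)) with hN
  set k : ℝ := (τ - γ * τ - β) * expKernel τ x a with hk
  have hderiv : ∀ t ∈ Icc 0 T, HasDerivWithinAt N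
      (-(2 * τ) * (Real.exp (-τ * t) * u x t) + k * (Real.exp (-τ * t) * u a t)) (Icc 0 T) t := by
    intro t ht
    have hd1 := hweak _ _ hK t ht
    have hd2 := (L.hasFDerivAt.comp_hasDerivWithinAt t (hUd t ht)).const_mul τ
    have hd3 : HasDerivWithinAt (fun t => Real.exp (-τ * t)) (Real.exp (-τ * t) * (-τ * 1))
        (Icc 0 T) t := ((hasDerivWithinAt_id t _).const_mul (-τ)).exp
    refine (hd3.mul (hd1.add hd2)).congr_deriv ?_
    have hparts := (hH t ht).integral_deriv_mul_add hτ hx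
    have hLU : L (U t) = ∫ y in Iio a, u y t * expKernel τ x y := by
      rw [hL]
      refine integral_congr_ae ?_
      filter_upwards [hU t ht] with y hy
      rw [hy]
    rw [← hLU] at hparts
    simp only [Pi.add_apply, Function.comp_apply]
    rw [← hL]
    linear_combination (-Real.exp (-τ * t)) * hparts
  have hi : ∀ z ≤ a, IntervalIntegrable (fun t => Real.exp (-τ * t) * u z t) volume 0 T := by
    intro z hz
    refine ContinuousOn.intervalIntegrable ?_
    rw [uIcc_of_le hT.le]
    exact (Continuous.continuousOn (by fun_prop)).mul (hcont z hz)
  have hftc := intervalIntegral.integral_eq_sub_of_hasDerivAt_of_le hT.le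
    (fun t ht => (hderiv t ht).continuousWithinAt)
    (fun t ht => (hderiv t (Ioo_subset_Icc_self ht)).hasDerivAt (Icc_mem_nhds ht.1 ht.2))
    (((hi x hx).const_mul _).add ((hi a le_rfl).const_mul _))
  rw [intervalIntegral.integral_add ((hi x hx).const_mul _) ((hi a le_rfl).const_mul _),
    intervalIntegral.integral_const_mul, intervalIntegral.integral_const_mul] at hftc
  have hN0 : N 0 = ∫ y in Iio a, f y * expKernel τ x y := by
    have e1 : L (U 0) = 0 := by
      rw [hL]
      refine (integral_congr_ae ?_).trans (integral_zero' ℝ ℝ)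
      filter_upwards [hU 0 h0, ae_restrict_mem measurableSet_Iio] with y hy hya
      rw [hy, hu0 y (le_of_lt hya), zero_mul, Pi.zero_apply]
    have e2 : ∫ y in Iio a, Ut 0 y * expKernel τ x y = ∫ y in Iio a, f y * expKernel τ x y := by
      refine integral_congr_ae ?_
      filter_upwards [hUt0] with y hy
      rw [hy]
    simp [hN, e1, e2, hu0 a le_rfl]
  have hNT : N T = Real.exp (-τ * T) * ((∫ y in Iio a, (Ut T y + τ * U T y) * expKernel τ x y) +
      γ * u a T * expKernel τ x a) := by
    have e : ∫ y in Iio a, (Ut T y + τ * U T y) * expKernel τ x y =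
        (∫ y in Iio a, Ut T y * expKernel τ x y) + τ * L (U T) := by
      rw [hL, ← integral_const_mul, ← integral_add (integrable_mul_expKernel hτ x (Lp.memLp _))
        ((integrable_mul_expKernel hτ x (Lp.memLp _)).const_mul _)]
      exact integral_congr_ae (.of_forall fun y => by ring)
    rw [e]
    simp only [hN]
    ring
  rw [hN0, hNT] at hftc
  simp only [waveLaplace]
  linear_combination -hftc

end WeakSolution

/-! ### Expansion of the reflection coefficient, and general facts on asymptotic expansions. -/

/-- The reflection coefficient of the boundary condition at the end point of the half-line. -/
noncomputable def reflectionCoeff (γ β τ : ℝ) : ℝ := ((1 - γ) * τ - β) / ((1 + γ) * τ + β)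

section Expansion

variable {γ β : ℝ}

lemma eventually_add_ne_zero (hγ : 0 ≤ γ) : ∀ᶠ τ : ℝ in atTop, (1 + γ) * τ + β ≠ 0 := by
  filter_upwards [eventually_gt_atTop (-β / (1 + γ))] with τ hτ
  rw [div_lt_iff₀ (by linarith)] at hτ
  exact (by linarith : 0 < (1 + γ) * τ + β).ne'

lemma isBigO_div_add (hγ : 0 ≤ γ) :
    (fun τ : ℝ => τ / ((1 + γ) * τ + β)) =O[atTop] fun _ => (1 : ℝ) := by
  have h1 : Tendsto (fun τ : ℝ => 1 / ((1 + γ) + β / τ)) atTop (𝓝 (1 / ((1 + γ) + 0))) :=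
    tendsto_const_nhds.div (tendsto_const_nhds.add (tendsto_const_nhds.div_atTop tendsto_id))
      (by linarith)
  refine h1.isBigO_one ℝ |>.congr' ?_ .rfl
  filter_upwards [eventually_gt_atTop 0, eventually_add_ne_zero (β := β) hγ] with τ hτ h
  have : (1 + γ) + β / τ ≠ 0 := by
    intro h'; apply h; field_simp at h'; linarith
  field_simp

lemma reflectionCoeff_eq {τ : ℝ} (h : (1 + γ) * τ + β ≠ 0) :
    reflectionCoeff γ β τ = 2 * (τ / ((1 + γ) * τ + β)) - 1 := by
  rw [reflectionCoeff, ← mul_div_assoc, div_sub_one h]; ring_nf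

lemma isBigO_reflectionCoeff (hγ : 0 ≤ γ) :
    reflectionCoeff γ β =O[atTop] fun _ => (1 : ℝ) := by
  have h := ((isBigO_div_add (β := β) hγ).const_mul_left 2).sub
    (isBigO_refl (fun _ : ℝ => (1 : ℝ)) atTop)
  refine h.congr' ?_ .rfl
  filter_upwards [eventually_add_ne_zero (β := β) hγ] with τ h
  rw [reflectionCoeff_eq h]

/-- With `r = -β/(1+γ)` the quotient `τ/((1+γ)τ+β)` is a geometric series in `r/τ`; truncating it
leaves an exact remainder, from which the induction peels one term at a time. -/
lemma reflectionCoeff_sub_sum (hγ : 0 ≤ γ) {τ : ℝ} (hτ : 0 < τ) (h : (1 + γ) * τ + β ≠ 0) (n : ℕ) :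
    reflectionCoeff γ β τ / (2 * τ) -
        ∑ k ∈ Finset.range (n + 2), expansionCoeff γ β k / τ ^ k =
      (-β / (1 + γ)) ^ (n + 1) * (τ / ((1 + γ) * τ + β)) * (1 / τ ^ (n + 2)) := by
  have hg : 1 + γ ≠ 0 := by linarith
  have hg' : γ + 1 ≠ 0 := by linarith
  have ht := hτ.ne'
  induction n with
  | zero =>
    simp only [Finset.sum_range_succ, Finset.sum_range_zero, expansionCoeff, reflectionCoeff]
    -- The denominator becomes a variable, so that clearing denominators needs only `D ≠ 0`.
    obtain ⟨D, rfl⟩ : ∃ D, β = D - (1 + γ) * τ := ⟨β + (1 + γ) * τ, by ring⟩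
    rw [add_sub_cancel] at h ⊢
    rw [add_comm γ 1]
    obtain ⟨g, rfl⟩ : ∃ g, γ = g - 1 := ⟨γ + 1, by ring⟩
    rw [add_sub_cancel] at *
    simp only [zero_add, pow_one]
    field_simp
    ring
  | succ n ih =>
    rw [Finset.sum_range_succ, ← sub_sub, ih, expansionCoeff, add_comm γ 1]
    generalize hr : (-β / (1 + γ)) = r
    have hβ : β = -(r * (1 + γ)) := by rw [← hr]; field_simp
    obtain ⟨e, rfl⟩ : ∃ e, r = τ - e := ⟨τ - r, by ring⟩
    have hD : (1 + γ) * τ + β = (1 + γ) * e := by rw [hβ]; ring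
    have he : e ≠ 0 := fun he => h (by rw [hD, he, mul_zero])
    rw [hD, hβ]
    field_simp
    ring

lemma hasAsymptoticExpansion_reflectionCoeff (hγ : 0 ≤ γ) :
    HasAsymptoticExpansion (fun τ => reflectionCoeff γ β τ / (2 * τ)) (expansionCoeff γ β) := by
  have h1 : (fun τ => reflectionCoeff γ β τ / (2 * τ)) =O[atTop] fun τ : ℝ => 1 / τ := by
    have := ((isBigO_reflectionCoeff (β := β) hγ).const_mul_left (1 / 2)).mul
      (isBigO_refl (fun τ : ℝ => 1 / τ) atTop)
    refine this.congr' (.of_forall fun τ => ?_) (.of_forall fun τ => ?_)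
    · dsimp only
      rw [div_mul_eq_mul_div, one_mul, div_mul_div_comm, mul_one]
    · dsimp only; rw [one_mul]
  -- The exact remainder formula starts with two terms; orders `0` and `1` follow from the cruder
  -- bound `O(1/τ)`.
  rintro (_ | _ | n)
  · have h2 : (fun τ : ℝ => 1 / τ) =O[atTop] fun _ => (1 : ℝ) := by
      simp only [one_div]
      exact tendsto_inv_atTop_zero.isBigO_one ℝ
    simpa using h1.trans h2
  · simpa [expansionCoeff] using h1
  · have h2 := ((isBigO_div_add (β := β) hγ).const_mul_left ((-β / (1 + γ)) ^ (n + 1))).mul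
      (isBigO_refl (fun τ : ℝ => 1 / τ ^ (n + 2)) atTop)
    refine h2.congr' ?_ (.of_forall fun τ => one_mul _)
    filter_upwards [eventually_gt_atTop 0, eventually_add_ne_zero (β := β) hγ] with τ hτ h
    rw [reflectionCoeff_sub_sum hγ hτ h]

lemma isBigO_exp_neg_mul {δ m : ℝ} (hδ : 0 < δ) {h : ℝ → ℝ} (hh : h =O[atTop] fun τ => τ ^ m)
    (N : ℕ) : (fun τ => Real.exp (-δ * τ) * h τ) =O[atTop] fun τ => 1 / τ ^ N := by
  have h1 := (isLittleO_exp_neg_mul_rpow_atTop hδ (-m - N)).isBigO.mul hh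
  refine h1.congr' .rfl ?_
  filter_upwards [eventually_gt_atTop 0] with τ hτ
  rw [← Real.rpow_add hτ, show -m - (N : ℝ) + m = -(N : ℝ) by ring, Real.rpow_neg hτ.le,
    Real.rpow_natCast, one_div]

/-- An exponentially small factor absorbs any power of `τ`, so such a perturbation is invisible at
every order. -/
lemma HasAsymptoticExpansion.of_remainder {F G h : ℝ → ℝ} {c : ℕ → ℝ} {δ m : ℝ}
    (hG : HasAsymptoticExpansion G c) (hδ : 0 < δ) (hh : h =O[atTop] fun τ => τ ^ m)
    (hF : ∀ᶠ τ in atTop, F τ = G τ + Real.exp (-δ * τ) * h τ) : HasAsymptoticExpansion F c := by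
  intro N
  refine ((hG N).add (isBigO_exp_neg_mul hδ hh N)).congr' ?_ .rfl
  filter_upwards [hF] with τ hτ
  rw [hτ]; ring

/-- The coefficient of order `N` of an asymptotic expansion as a limit. -/
lemma HasAsymptoticExpansion.tendsto {F : ℝ → ℝ} {c : ℕ → ℝ} (hF : HasAsymptoticExpansion F c)
    (N : ℕ) : Tendsto (fun τ => τ ^ N * (F τ - ∑ k ∈ Finset.range N, c k / τ ^ k)) atTop
      (𝓝 (c N)) := by
  -- The expansion to order `N` would give only boundedness; using order `N + 1` gives the limit.
  have h1 := (isBigO_refl (fun τ : ℝ => τ ^ N) atTop).mul (hF (N + 1))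
  have h2 : Tendsto (fun τ => τ ^ N * (F τ - ∑ k ∈ Finset.range (N + 1), c k / τ ^ k)) atTop
      (𝓝 0) := by
    refine h1.trans_tendsto (tendsto_inv_atTop_zero.congr' ?_)
    filter_upwards [eventually_gt_atTop 0] with τ hτ
    field_simp
    ring
  refine (by simpa using h2.add_const (c N) : Tendsto _ _ (𝓝 (c N))).congr' ?_
  filter_upwards [eventually_gt_atTop 0] with τ hτ
  rw [Finset.sum_range_succ]
  field_simp
  ring

/-- Here `1 + 2c₁ = 2/(γ+1)`, which is nonzero and determines `γ`; then `c₂ = -β/(γ+1)²` determines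
`β`. -/
lemma HasAsymptoticExpansion.recoversParameters {F : ℝ → ℝ} (hγ : 0 ≤ γ)
    (hF : HasAsymptoticExpansion F (expansionCoeff γ β)) : RecoversParameters F γ β := by
  have hg : γ + 1 ≠ 0 := by linarith
  have hc : 1 + 2 * expansionCoeff γ β 1 = 2 / (γ + 1) := by
    simp only [expansionCoeff]; field_simp; ring
  refine ⟨expansionCoeff γ β 1, expansionCoeff γ β 2, ?_, ?_, ?_, ?_, ?_⟩
  · simpa [expansionCoeff] using hF.tendsto 1
  · simpa [Finset.sum_range_succ, expansionCoeff] using hF.tendsto 2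
  · rw [hc]; positivity
  · rw [hc]; simp only [expansionCoeff]; field_simp; ring
  · simp only [expansionCoeff]; field_simp

end Expansion

/-! ### Distances, the free field and the source integral. -/

section Geometry

lemma setDist_Ioi_Icc {x p q : ℝ} (hpq : p ≤ q) (hqx : q < x) :
    setDist (Ioi x) (Icc p q) = x - q := by
  refine IsGLB.csInf_eq ⟨?_, fun m hm => ?_⟩ ⟨_, x + 1, by simp, q, right_mem_Icc.2 hpq, rfl⟩
  · rintro r ⟨y, hy, z, hz, rfl⟩
    rw [Real.dist_eq]
    have h1 := mem_Ioi.1 hy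
    exact le_trans (by linarith [hz.2]) (le_abs_self _)
  -- The infimum is not attained, since the ray is open; the points `x + e` approach it.
  · refine le_of_forall_pos_le_add fun e he => ?_
    have := hm ⟨x + e, by simpa using he, q, right_mem_Icc.2 hpq, rfl⟩
    rw [Real.dist_eq, abs_of_pos (by linarith)] at this
    linarith

end Geometry

section Source

variable {a b ε τ x : ℝ} {f : ℝ → ℝ}

lemma integral_mul_expKernel_eq_sourceB (hsupp : ∀ᵐ x, x ∉ sourceB b ε → f x = 0) {s : Set ℝ}
    (hs : MeasurableSet s) (hBs : sourceB b ε ⊆ s) :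
    ∫ y in s, f y * expKernel τ x y = ∫ y in sourceB b ε, f y * expKernel τ x y := by
  refine setIntegral_eq_of_subset_of_ae_sdiff_eq_zero hs.nullMeasurableSet hBs ?_
  filter_upwards [hsupp] with y hy hyB
  rw [hy hyB.2, zero_mul]

lemma sourceB_subset_Iio (hba : b < a) : sourceB b ε ⊆ Iio a := fun _ hy => hy.2.trans_lt hba

lemma two_mul_freeField (hsupp : ∀ᵐ x, x ∉ sourceB b ε → f x = 0) (hba : b < a) (hτ : 0 < τ) :
    2 * τ * freeField f x τ = ∫ y in Iio a, f y * expKernel τ x y := by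
  rw [integral_mul_expKernel_eq_sourceB hsupp measurableSet_Iio (sourceB_subset_Iio hba),
    ← integral_mul_expKernel_eq_sourceB hsupp .univ (subset_univ _), setIntegral_univ, freeField,
    ← mul_assoc, mul_one_div_cancel (by positivity), one_mul]
  exact integral_congr_ae (.of_forall fun y => mul_comm _ _)

lemma sourceIntegral_eq (hε : 0 < ε) :
    sourceIntegral b ε f τ = ∫ y in sourceB b ε, Real.exp (-τ * (b - y)) * f y := by
  rw [sourceIntegral, intervalIntegral.integral_of_le (by linarith), sourceB,
    integral_Icc_eq_integral_Ioc]

lemma integral_sourceB_mul_expKernel (hε : 0 < ε) (hx : b ≤ x) :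
    ∫ y in sourceB b ε, f y * expKernel τ x y =
      Real.exp (-τ * (x - b)) * sourceIntegral b ε f τ := by
  rw [sourceIntegral_eq hε, ← integral_const_mul]
  refine setIntegral_congr_fun measurableSet_Icc fun y hy => ?_
  rw [expKernel_of_le (hy.2.trans hx), ← mul_assoc, ← Real.exp_add, mul_comm]
  ring_nf

/-- To the right of `B` one has `|x-y| = (x-b) + (b-y)`, so the field is a pure exponential in `x`
with amplitude given by the source integral. -/
lemma freeField_of_ge (hε : 0 < ε) (hsupp : ∀ᵐ x, x ∉ sourceB b ε → f x = 0) (hx : b ≤ x)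
    (hτ : 0 < τ) :
    freeField f x τ = Real.exp (-τ * (x - b)) * sourceIntegral b ε f τ / (2 * τ) := by
  have h := two_mul_freeField (x := x) hsupp (lt_add_one b) hτ
  rw [integral_mul_expKernel_eq_sourceB hsupp measurableSet_Iio (sourceB_subset_Iio (lt_add_one b)),
    integral_sourceB_mul_expKernel hε hx] at h
  rw [eq_div_iff (by positivity), ← h, mul_comm]

lemma hasDerivAt_freeField (hε : 0 < ε) (hsupp : ∀ᵐ x, x ∉ sourceB b ε → f x = 0) (hx : b < x)
    (hτ : 0 < τ) :
    HasDerivAt (fun x => freeField f x τ) (-τ * freeField f x τ) x := by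
  have h1 : HasDerivAt (fun x => Real.exp (-τ * (x - b)) * (sourceIntegral b ε f τ / (2 * τ)))
      (Real.exp (-τ * (x - b)) * (-τ * 1) * (sourceIntegral b ε f τ / (2 * τ))) x :=
    (((hasDerivAt_id x).sub_const b).const_mul (-τ)).exp.mul_const _
  refine (h1.congr_of_eventuallyEq ?_).congr_deriv ?_
  · filter_upwards [Ioi_mem_nhds hx] with z hz
    rw [freeField_of_ge hε hsupp (le_of_lt hz) hτ]; ring
  · rw [freeField_of_ge hε hsupp hx.le hτ]; ring

lemma abs_sourceIntegral_le (hε : 0 < ε) (hτ : 0 ≤ τ) (hf : IntegrableOn f (sourceB b ε)) :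
    |sourceIntegral b ε f τ| ≤ ∫ y in sourceB b ε, |f y| := by
  rw [sourceIntegral_eq hε, ← Real.norm_eq_abs]
  refine norm_integral_le_of_norm_le hf.abs ?_
  filter_upwards [ae_restrict_mem measurableSet_Icc] with y hy
  rw [norm_mul, Real.norm_eq_abs, Real.norm_eq_abs, Real.abs_exp]
  refine mul_le_of_le_one_left (abs_nonneg _) (Real.exp_le_one_iff.2 ?_)
  have := hy.2
  nlinarith

/-- This is the form in which the lower bound on the source is used: division by the source integral
costs at most a power of `τ`. -/
lemma NonvanishingAtEndpoint.isBigO (h : NonvanishingAtEndpoint b ε f) :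
    (∀ᶠ τ in atTop, sourceIntegral b ε f τ ≠ 0) ∧
      ∃ μ : ℝ, (fun τ => (sourceIntegral b ε f τ)⁻¹) =O[atTop] fun τ => τ ^ μ := by
  obtain ⟨μ, hμ⟩ := h
  obtain ⟨c, hc0, hc⟩ := ENNReal.lt_iff_exists_nnreal_btwn.1 hμ
  have hc0' : 0 < (c : ℝ) := by exact_mod_cast hc0
  have hev : ∀ᶠ τ in atTop, (c : ℝ) < τ ^ μ * |sourceIntegral b ε f τ| := by
    filter_upwards [eventually_lt_of_lt_liminf hc] with τ hτ
    exact (ENNReal.lt_ofReal_iff_toReal_lt ENNReal.coe_ne_top).1 hτ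
  have hne : ∀ᶠ τ in atTop, sourceIntegral b ε f τ ≠ 0 := by
    filter_upwards [hev] with τ hτ h0
    rw [h0, abs_zero, mul_zero] at hτ
    exact hτ.not_gt hc0'
  refine ⟨hne, μ, IsBigO.of_bound (c : ℝ)⁻¹ ?_⟩
  filter_upwards [hev, hne, eventually_gt_atTop 0] with τ hτ hS hτ0
  have hS' := abs_pos.2 hS
  rw [norm_inv, Real.norm_eq_abs, Real.norm_eq_abs, abs_of_pos (Real.rpow_pos_of_pos hτ0 _),
    inv_mul_eq_div, inv_le_iff_one_le_mul₀ hS', div_mul_eq_mul_div, le_div_iff₀ hc0', one_mul]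
  exact hτ.le

end Source

/-! ### Uniform bounds for potentials. -/

section Potential

variable {a : ℝ} {p q : ℝ → ℝ}

/-- Potentials of densities growing linearly in `τ` grow at most linearly, locally uniformly. -/
lemma exists_integral_abs_mul_expKernel_le (hp : MemLp p 2 (halfLineMeasure a))
    (hq : MemLp q 2 (halfLineMeasure a)) (r : ℝ) :
    ∃ C : ℝ, 0 ≤ C ∧ ∀ τ ≥ 1, ∀ x, |x| ≤ r →
      ∫ y in Iio a, |(p y + τ * q y) * expKernel τ x y| ≤ C * τ := by
  have hi := integrable_mul_expKernel one_pos 0 (hp.abs.add hq.abs)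
  refine ⟨Real.exp r * ∫ y in Iio a, (|p y| + |q y|) * expKernel 1 0 y, ?_, fun τ hτ x hx => ?_⟩
  · refine mul_nonneg (Real.exp_pos _).le (integral_nonneg fun y => ?_)
    have := (expKernel_pos 1 0 y).le
    positivity
  · have h0 : 0 < τ := by linarith
    rw [mul_right_comm, ← integral_const_mul]
    refine integral_mono_of_nonneg (.of_forall fun y => abs_nonneg _) (hi.const_mul _)
      (.of_forall fun y => ?_)
    dsimp only
    rw [abs_mul, abs_of_pos (expKernel_pos τ x y)]
    -- For `τ ≥ 1` the kernel is dominated by the one with `τ = 1`, whose centre is then moved to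
    -- `0`; this gives a majorant independent of `τ` and `x`.
    have h1 : expKernel τ x y ≤ Real.exp r * expKernel 1 0 y := by
      refine le_trans (Real.exp_le_exp.2 ?_)
        ((expKernel_le_mul zero_le_one (x := x) (x₀ := 0) (r := r) (by simpa using hx) y).trans_eq
          (by rw [one_mul]))
      have := abs_nonneg (x - y)
      nlinarith
    have h2 : |p y + τ * q y| ≤ τ * (|p y| + |q y|) := by
      refine (abs_add_le _ _).trans ?_
      rw [abs_mul, abs_of_pos h0]
      nlinarith [abs_nonneg (p y)]
    calc _ ≤ τ * (|p y| + |q y|) * (Real.exp r * expKernel 1 0 y) :=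
          mul_le_mul h2 h1 (expKernel_pos _ _ _).le (by positivity)
      _ = _ := by ring

end Potential

/-! ### Exact formulas for the echo and for both observed quantities. -/

section Scattering

variable {a b ε T γ β : ℝ} {f : ℝ → ℝ} {u : ℝ → ℝ → ℝ} {p q : ℝ → ℝ}

/-- The potential of the density `p + τ q` on the half-line. -/
noncomputable def endPotential (a : ℝ) (p q : ℝ → ℝ) (τ x : ℝ) : ℝ :=
  ∫ y in Iio a, (p y + τ * q y) * expKernel τ x y

/-- `2τ` times the amplitude of the wave coming back from the end point `a`. -/
noncomputable def echo (a T γ β : ℝ) (u : ℝ → ℝ → ℝ) (τ : ℝ) : ℝ :=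
  (τ - γ * τ - β) * waveLaplace T u a τ - Real.exp (-τ * T) * (γ * u a T)

/-- The part of `echo` that is due to the finiteness of the observation time `T`, up to the
factor `e^{-τ T}`. -/
noncomputable def echoRemainder (a T γ β : ℝ) (u : ℝ → ℝ → ℝ) (p q : ℝ → ℝ) (τ : ℝ) : ℝ :=
  -(reflectionCoeff γ β τ * (endPotential a p q τ a + γ * u a T)) - γ * u a T

/-- The representation of `w - v` by the potential of the state at time `T` and the echo. -/
def HasEchoRepresentation (a T γ β : ℝ) (f : ℝ → ℝ) (u : ℝ → ℝ → ℝ) (p q : ℝ → ℝ) : Prop :=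
  ∀ τ : ℝ, 0 < τ → ∀ x ≤ a, 2 * τ * (waveLaplace T u x τ - freeField f x τ) =
    -(Real.exp (-τ * T) * endPotential a p q τ x) + echo a T γ β u τ * expKernel τ x a

lemma MemLp.add_const_mul {τ : ℝ} (hp : MemLp p 2 (halfLineMeasure a))
    (hq : MemLp q 2 (halfLineMeasure a)) :
    MemLp (fun y => p y + τ * q y) 2 (halfLineMeasure a) := hp.add (hq.const_mul τ)

lemma hasDerivAt_endPotential {τ : ℝ} (hτ : 0 < τ) (x : ℝ) (hp : MemLp p 2 (halfLineMeasure a))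
    (hq : MemLp q 2 (halfLineMeasure a)) :
    HasDerivAt (endPotential a p q τ)
      (-∫ y in Iio a, (p y + τ * q y) * expKernelDeriv τ x y) x := by
  rw [← integral_neg]
  exact hasDerivAt_integral_mul_expKernel hτ x (MemLp.add_const_mul hp hq)

/-- At `x = a` the representation is a linear equation for `w(a)` with coefficient `(1+γ)τ + β`;
substituting its solution produces the reflection coefficient. -/
lemma echo_eq (hε : 0 < ε) (hba : b < a) (hsupp : ∀ᵐ x, x ∉ sourceB b ε → f x = 0) {τ : ℝ}
    (hτ : 0 < τ) (hne : (1 + γ) * τ + β ≠ 0) (hrep : HasEchoRepresentation a T γ β f u p q) :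
    echo a T γ β u τ = reflectionCoeff γ β τ *
        (Real.exp (-τ * (a - b)) * sourceIntegral b ε f τ) +
      Real.exp (-τ * T) * echoRemainder a T γ β u p q τ := by
  have h := hrep τ hτ a le_rfl
  have hK : expKernel τ a a = 1 := by simp [expKernel]
  rw [freeField_of_ge hε hsupp hba.le hτ, hK, echo] at h
  have hS : 2 * τ * (Real.exp (-τ * (a - b)) * sourceIntegral b ε f τ / (2 * τ)) =
    Real.exp (-τ * (a - b)) * sourceIntegral b ε f τ := by field_simp
  rw [mul_sub, hS] at h
  have hw : waveLaplace T u a τ = (Real.exp (-τ * (a - b)) * sourceIntegral b ε f τ -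
      Real.exp (-τ * T) * (endPotential a p q τ a + γ * u a T)) / ((1 + γ) * τ + β) := by
    rw [eq_div_iff hne]; linear_combination h
  rw [echo, echoRemainder, reflectionCoeff, hw]
  ring

lemma hasDerivAt_waveLaplace (ha : 0 < a) (hε : 0 < ε) (hb : b < 0)
    (hsupp : ∀ᵐ x, x ∉ sourceB b ε → f x = 0) (hp : MemLp p 2 (halfLineMeasure a))
    (hq : MemLp q 2 (halfLineMeasure a)) {τ : ℝ} (hτ : 0 < τ)
    (hrep : HasEchoRepresentation a T γ β f u p q) :
    HasDerivAt (fun x => waveLaplace T u x τ) (-τ * freeField f 0 τ +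
      (Real.exp (-τ * T) * (∫ y in Iio a, (p y + τ * q y) * expKernelDeriv τ 0 y) +
        echo a T γ β u τ * (τ * Real.exp (-τ * a))) / (2 * τ)) 0 := by
  have hexp : HasDerivAt (fun x => Real.exp (-τ * (a - x))) (Real.exp (-τ * (a - 0)) *
      (-τ * (0 - 1))) 0 :=
    (((hasDerivAt_const (0 : ℝ) a).sub (hasDerivAt_id (0 : ℝ))).const_mul (-τ)).exp
  have h1 := (hasDerivAt_freeField hε hsupp hb hτ).add
    ((((hasDerivAt_endPotential hτ 0 hp hq).const_mul (Real.exp (-τ * T))).neg.add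
      (hexp.const_mul (echo a T γ β u τ))).div_const (2 * τ))
  refine (h1.congr_of_eventuallyEq ?_).congr_deriv ?_
  · filter_upwards [Iio_mem_nhds ha] with x hx
    have h := hrep τ hτ x (le_of_lt hx)
    rw [expKernel_of_ge (le_of_lt hx)] at h
    simp only [Pi.add_apply, Pi.neg_apply]
    rw [← h]
    field_simp
    ring
  · rw [sub_zero]; ring

/-- Since `v' = -τv` at `0`, one has `I = v (w' + τw)`. The operator `d/dx + τ` annihilates the free
wave `e^{-τx}` and multiplies the echo `e^{-τ(a-x)}` by `2τ`. -/
lemma indicatorI_eq (ha : 0 < a) (hε : 0 < ε) (hb : b < 0)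
    (hsupp : ∀ᵐ x, x ∉ sourceB b ε → f x = 0) (hp : MemLp p 2 (halfLineMeasure a))
    (hq : MemLp q 2 (halfLineMeasure a)) {τ : ℝ} (hτ : 0 < τ)
    (hrep : HasEchoRepresentation a T γ β f u p q) :
    indicatorI T f u τ = freeField f 0 τ / (2 * τ) * (Real.exp (-τ * T) *
        ((∫ y in Iio a, (p y + τ * q y) * expKernelDeriv τ 0 y) - τ * endPotential a p q τ 0) +
      2 * τ * Real.exp (-τ * a) * echo a T γ β u τ) := by
  have h := hrep τ hτ 0 ha.le
  rw [expKernel_of_ge ha.le, sub_zero] at h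
  have hw : waveLaplace T u 0 τ = freeField f 0 τ + (-(Real.exp (-τ * T) *
      endPotential a p q τ 0) + echo a T γ β u τ * Real.exp (-τ * a)) / (2 * τ) := by
    rw [← h]; field_simp; ring
  rw [indicatorI, (hasDerivAt_freeField hε hsupp hb hτ).deriv,
    (hasDerivAt_waveLaplace ha hε hb hsupp hp hq hτ hrep).deriv, hw]
  field_simp
  ring

lemma integrableOn_sourceB (hf : MemLp f 2 volume) : IntegrableOn f (sourceB b ε) :=
  (hf.locallyIntegrable (by norm_num)).integrableOn_isCompact isCompact_Icc

lemma backScattering_aux (hba : b < a) {τ : ℝ} (hτ : 0 < τ)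
    (hrep : HasEchoRepresentation a T γ β f u p q) {y : ℝ} (hy : y ∈ sourceB b ε) :
    f y * (waveLaplace T u y τ - freeField f y τ) =
      (-(Real.exp (-τ * T)) / (2 * τ)) * (f y * endPotential a p q τ y) +
        (echo a T γ β u τ / (2 * τ)) * (f y * expKernel τ a y) := by
  have h := hrep τ hτ y (hy.2.trans hba.le)
  have hsymm : expKernel τ y a = expKernel τ a y := by rw [expKernel, expKernel, abs_sub_comm]
  have hw : waveLaplace T u y τ - freeField f y τ = (-(Real.exp (-τ * T) *
      endPotential a p q τ y) + echo a T γ β u τ * expKernel τ a y) / (2 * τ) := by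
    rw [← hsymm, ← h]; field_simp
  rw [hw]; ring

lemma integrableOn_mul_endPotential (hf : MemLp f 2 volume) (hp : MemLp p 2 (halfLineMeasure a))
    (hq : MemLp q 2 (halfLineMeasure a)) {τ : ℝ} (hτ : 0 < τ) :
    IntegrableOn (fun y => f y * endPotential a p q τ y) (sourceB b ε) :=
  (integrableOn_sourceB hf).mul_continuousOn
    (fun x _ => (hasDerivAt_endPotential hτ x hp hq).continuousAt.continuousWithinAt) isCompact_Icc

lemma integrableOn_mul_expKernel (hf : MemLp f 2 volume) (τ : ℝ) :
    IntegrableOn (fun y => f y * expKernel τ a y) (sourceB b ε) :=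
  (integrableOn_sourceB hf).mul_continuousOn (continuous_expKernel τ a).continuousOn isCompact_Icc

lemma integrableOn_mul_sub (hba : b < a) (hf : MemLp f 2 volume)
    (hp : MemLp p 2 (halfLineMeasure a)) (hq : MemLp q 2 (halfLineMeasure a)) {τ : ℝ} (hτ : 0 < τ)
    (hrep : HasEchoRepresentation a T γ β f u p q) :
    IntegrableOn (fun y => f y * (waveLaplace T u y τ - freeField f y τ)) (sourceB b ε) :=
  IntegrableOn.congr_fun
    (((integrableOn_mul_endPotential hf hp hq hτ).const_mul _).add
      ((integrableOn_mul_expKernel hf τ).const_mul _))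
    (fun _ hy => (backScattering_aux hba hτ hrep hy).symm) measurableSet_Icc

/-- By symmetry of the kernel, integrating the echo against `f` reproduces the source integral with
a second factor `e^{-τ(a-b)}` for the way back. -/
lemma backScattering_eq (hba : b < a) (hε : 0 < ε) (hf : MemLp f 2 volume)
    (hp : MemLp p 2 (halfLineMeasure a)) (hq : MemLp q 2 (halfLineMeasure a)) {τ : ℝ} (hτ : 0 < τ)
    (hrep : HasEchoRepresentation a T γ β f u p q) :
    backScattering b ε T f u τ = (1 / (2 * τ)) *
      (-(Real.exp (-τ * T) * ∫ y in sourceB b ε, f y * endPotential a p q τ y) +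
        echo a T γ β u τ * (Real.exp (-τ * (a - b)) * sourceIntegral b ε f τ)) := by
  rw [backScattering, setIntegral_congr_fun (s := sourceB b ε) measurableSet_Icc
      (fun y hy => backScattering_aux hba hτ hrep hy),
    integral_add ((integrableOn_mul_endPotential hf hp hq hτ).const_mul _)
      ((integrableOn_mul_expKernel hf τ).const_mul _), integral_const_mul, integral_const_mul,
    integral_sourceB_mul_expKernel hε hba.le]
  ring

lemma IsWeakSolution.exists_hasEchoRepresentation (hba : b < a)
    (hsupp : ∀ᵐ x, x ∉ sourceB b ε → f x = 0) (hu : IsWeakSolution a T γ β f u) (hT : 0 < T) :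
    ∃ p q : ℝ → ℝ, MemLp p 2 (halfLineMeasure a) ∧ MemLp q 2 (halfLineMeasure a) ∧
      HasEchoRepresentation a T γ β f u p q := by
  obtain ⟨-, p, q, hp, hq, h⟩ := hu.exists_waveLaplace_eq hT
  refine ⟨p, q, hp, hq, fun τ hτ x hx => ?_⟩
  rw [mul_sub, two_mul_freeField hsupp hba hτ, h τ hτ x hx, echo, endPotential]
  ring

end Scattering

/-! ### Polynomial growth in `τ` of the remainders. -/

section Growth

variable {a b ε T γ β : ℝ} {f : ℝ → ℝ} {u : ℝ → ℝ → ℝ} {p q : ℝ → ℝ}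

lemma isBigO_exp_neg_mul_one {c : ℝ} (hc : 0 ≤ c) :
    (fun τ : ℝ => Real.exp (-τ * c)) =O[atTop] fun _ => (1 : ℝ) := by
  refine IsBigO.of_bound 1 ?_
  filter_upwards [eventually_ge_atTop 0] with τ hτ
  rw [norm_one, mul_one, Real.norm_eq_abs, Real.abs_exp, Real.exp_le_one_iff]
  nlinarith

lemma isBigO_one_id : (fun _ : ℝ => (1 : ℝ)) =O[atTop] fun τ : ℝ => τ :=
  (isLittleO_const_id_atTop (1 : ℝ)).isBigO

lemma isBigO_endPotential (hp : MemLp p 2 (halfLineMeasure a))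
    (hq : MemLp q 2 (halfLineMeasure a)) (x : ℝ) :
    (fun τ => endPotential a p q τ x) =O[atTop] fun τ : ℝ => τ := by
  obtain ⟨C, -, hC⟩ := exists_integral_abs_mul_expKernel_le hp hq |x|
  refine IsBigO.of_bound C ?_
  filter_upwards [eventually_ge_atTop 1] with τ hτ
  rw [Real.norm_eq_abs τ, abs_of_nonneg (by linarith)]
  exact (norm_integral_le_integral_norm _).trans (hC τ hτ x le_rfl)

lemma isBigO_integral_mul_expKernelDeriv (hp : MemLp p 2 (halfLineMeasure a))
    (hq : MemLp q 2 (halfLineMeasure a)) (x : ℝ) :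
    (fun τ => ∫ y in Iio a, (p y + τ * q y) * expKernelDeriv τ x y) =O[atTop]
      fun τ : ℝ => τ * τ := by
  obtain ⟨C, -, hC⟩ := exists_integral_abs_mul_expKernel_le hp hq |x|
  refine IsBigO.of_bound C ?_
  filter_upwards [eventually_ge_atTop 1] with τ hτ
  have hτ0 : 0 ≤ τ := by linarith
  rw [Real.norm_eq_abs (τ * τ), abs_of_nonneg (by positivity)]
  refine (norm_integral_le_integral_norm _).trans ?_
  have h : ∀ y, ‖(p y + τ * q y) * expKernelDeriv τ x y‖ =
      τ * |(p y + τ * q y) * expKernel τ x y| := fun y => by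
    rw [Real.norm_eq_abs, abs_mul, abs_mul, abs_expKernelDeriv hτ0,
      abs_of_pos (expKernel_pos τ x y)]
    ring
  simp only [h]
  rw [integral_const_mul]
  nlinarith [hC τ hτ x le_rfl]

lemma isBigO_integral_mul_endPotential (hf : MemLp f 2 volume)
    (hp : MemLp p 2 (halfLineMeasure a)) (hq : MemLp q 2 (halfLineMeasure a)) :
    (fun τ => ∫ y in sourceB b ε, f y * endPotential a p q τ y) =O[atTop] fun τ : ℝ => τ := by
  obtain ⟨C, -, hC⟩ := exists_integral_abs_mul_expKernel_le hp hq (|b - ε| + |b|)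
  refine IsBigO.of_bound (C * ∫ y in sourceB b ε, |f y|) ?_
  filter_upwards [eventually_ge_atTop 1] with τ hτ
  rw [Real.norm_eq_abs τ, abs_of_nonneg (by linarith), mul_right_comm, ← integral_const_mul]
  refine norm_integral_le_of_norm_le ((integrableOn_sourceB hf).abs.const_mul _) ?_
  filter_upwards [ae_restrict_mem measurableSet_Icc] with y hy
  rw [norm_mul, Real.norm_eq_abs, mul_comm]
  refine mul_le_mul_of_nonneg_right ?_ (abs_nonneg _)
  refine (norm_integral_le_integral_norm _).trans (hC τ hτ y ?_)
  refine abs_le.2 ⟨?_, ?_⟩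
  · linarith [hy.1, neg_abs_le (b - ε), abs_nonneg b]
  · linarith [hy.2, le_abs_self b, abs_nonneg (b - ε)]

lemma isBigO_echoRemainder (hγ : 0 ≤ γ) (hp : MemLp p 2 (halfLineMeasure a))
    (hq : MemLp q 2 (halfLineMeasure a)) :
    echoRemainder a T γ β u p q =O[atTop] fun τ : ℝ => τ := by
  have hconst : (fun _ : ℝ => γ * u a T) =O[atTop] fun τ : ℝ => τ :=
    (isBigO_const_const _ one_ne_zero _).trans isBigO_one_id
  have h := (isBigO_reflectionCoeff (β := β) hγ).mul ((isBigO_endPotential hp hq a).add hconst)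
  simp only [one_mul] at h
  exact h.neg_left.sub hconst

end Growth

/-! ### The two asymptotic expansions and the theorem. -/

section Asymptotics

variable {a b ε T γ β : ℝ} {f : ℝ → ℝ} {u : ℝ → ℝ → ℝ} {p q : ℝ → ℝ}

lemma hasAsymptoticExpansion_indicatorI (ha : 0 < a) (hb : b < 0) (hε : 0 < ε) (hγ : 0 ≤ γ)
    (hsupp : ∀ᵐ x, x ∉ sourceB b ε → f x = 0) (hnv : NonvanishingAtEndpoint b ε f)
    (hp : MemLp p 2 (halfLineMeasure a)) (hq : MemLp q 2 (halfLineMeasure a))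
    (hrep : HasEchoRepresentation a T γ β f u p q) (hT : 2 * (a - b) + b < T) :
    HasAsymptoticExpansion (normalized a b ε f (indicatorI T f u)) (expansionCoeff γ β) := by
  obtain ⟨hS, μ, hμ⟩ := hnv.isBigO
  set D : ℝ → ℝ := fun τ => ∫ y in Iio a, (p y + τ * q y) * expKernelDeriv τ 0 y
  -- A single inverse of the source integral remains, since the factor `v(0)` in `I` contains the
  -- source integral once.
  set h : ℝ → ℝ := fun τ => (sourceIntegral b ε f τ)⁻¹ * ((1 / (4 * (τ * τ))) *
    (D τ - τ * endPotential a p q τ 0 +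
      2 * τ * Real.exp (-τ * a) * echoRemainder a T γ β u p q τ)) with hh
  have hO : h =O[atTop] fun τ => τ ^ μ := by
    have e1 := (isBigO_integral_mul_expKernelDeriv hp hq 0).sub
      ((isBigO_refl (fun τ : ℝ => τ) atTop).mul (isBigO_endPotential hp hq 0))
    have e2 := ((isBigO_refl (fun τ : ℝ => τ) atTop).const_mul_left 2).mul
      (isBigO_exp_neg_mul_one ha.le) |>.mul (isBigO_echoRemainder (T := T) (β := β) (u := u) hγ hp hq)
    simp only [mul_one] at e2
    have e3 : (fun τ : ℝ => 1 / (4 * (τ * τ))) =O[atTop] fun τ => (τ * τ)⁻¹ := by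
      refine ((isBigO_refl (fun τ : ℝ => (τ * τ)⁻¹) atTop).const_mul_left (1 / 4)).congr_left
        fun τ => by rw [one_div, one_div, mul_inv 4]
    refine (hμ.mul (e3.mul (e1.add e2))).congr' .rfl ?_
    filter_upwards [eventually_gt_atTop 0] with τ hτ
    field_simp
  -- The factor `e^{τb}` of `v(0)` multiplies the `e^{-τT}` terms as well, which is why `T` need
  -- only exceed `2(a-b) + b`.
  refine (hasAsymptoticExpansion_reflectionCoeff hγ).of_remainder
    (δ := T - (2 * (a - b) + b)) (by linarith) hO ?_
  filter_upwards [hS, eventually_gt_atTop 0, eventually_add_ne_zero (β := β) hγ] with τ hSτ hτ hne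
  rw [normalized, obstacle, sourceB, setDist_Ioi_Icc (by linarith) (by linarith), sq_abs,
    indicatorI_eq ha hε hb hsupp hp hq hτ hrep,
    echo_eq hε (hb.trans ha) hsupp hτ hne hrep, freeField_of_ge hε hsupp hb.le hτ]
  simp only [hh]
  have x1 : Real.exp (-(T - (2 * (a - b) + b)) * τ) =
      Real.exp (2 * τ * (a - b)) * Real.exp (-τ * (0 - b)) * Real.exp (-τ * T) := by
    rw [← Real.exp_add, ← Real.exp_add]; ring_nf
  -- The lengths from `b` to `0`, `0` to `a` and `b` to `a` add up to `2(a-b)`. With this relation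
  -- the exponentials can be treated as opaque variables in a rational identity.
  have x2 : Real.exp (2 * τ * (a - b)) * Real.exp (-τ * (0 - b)) * Real.exp (-τ * a) *
      Real.exp (-τ * (a - b)) = 1 := by
    rw [← Real.exp_add, ← Real.exp_add, ← Real.exp_add, Real.exp_eq_one_iff]; ring
  have hDτ : (∫ y in Iio a, (p y + τ * q y) * expKernelDeriv τ 0 y) = D τ := rfl
  rw [x1, hDτ]
  generalize Real.exp (2 * τ * (a - b)) = E₁ at *
  generalize Real.exp (-τ * (0 - b)) = E₂ at *
  generalize Real.exp (-τ * T) = E₃ at *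
  generalize Real.exp (-τ * a) = E₄ at *
  generalize Real.exp (-τ * (a - b)) = E₅ at *
  generalize sourceIntegral b ε f τ = S at *
  generalize reflectionCoeff γ β τ = R at *
  generalize echoRemainder a T γ β u p q τ = m at *
  have hR : R / (2 * τ) = R / (2 * τ) * (E₁ * E₂ * E₄ * E₅) := by rw [x2, mul_one]
  rw [hR]
  field_simp
  ring

lemma hasAsymptoticExpansion_backScattering (hba : b < a) (hε : 0 < ε) (hγ : 0 ≤ γ)
    (hf : MemLp f 2 volume)
    (hsupp : ∀ᵐ x, x ∉ sourceB b ε → f x = 0) (hnv : NonvanishingAtEndpoint b ε f)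
    (hp : MemLp p 2 (halfLineMeasure a)) (hq : MemLp q 2 (halfLineMeasure a))
    (hrep : HasEchoRepresentation a T γ β f u p q) (hT : 2 * (a - b) < T) :
    HasAsymptoticExpansion (normalized a b ε f (backScattering b ε T f u))
      (expansionCoeff γ β) := by
  obtain ⟨hS, μ, hμ⟩ := hnv.isBigO
  set J : ℝ → ℝ := fun τ => ∫ y in sourceB b ε, f y * endPotential a p q τ y with hJ
  -- The integral of `f` against the end potential has no factor of the source integral, so both
  -- inverses remain and the growth exponent is `μ + μ`.
  set h : ℝ → ℝ := fun τ => (sourceIntegral b ε f τ)⁻¹ * (sourceIntegral b ε f τ)⁻¹ *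
    ((1 / (2 * τ)) * (-J τ + echoRemainder a T γ β u p q τ *
      (Real.exp (-τ * (a - b)) * sourceIntegral b ε f τ))) with hh
  have hO : h =O[atTop] fun τ => τ ^ (μ + μ) := by
    have hSO : sourceIntegral b ε f =O[atTop] fun _ => (1 : ℝ) := by
      refine IsBigO.of_bound (∫ y in sourceB b ε, |f y|) ?_
      filter_upwards [eventually_ge_atTop 0] with τ hτ
      rw [norm_one, mul_one]
      exact abs_sourceIntegral_le hε hτ (integrableOn_sourceB hf)
    have e2 := (isBigO_echoRemainder (T := T) (β := β) (u := u) hγ hp hq).mul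
      ((isBigO_exp_neg_mul_one (sub_nonneg.2 hba.le)).mul hSO)
    simp only [mul_one] at e2
    have e3 : (fun τ : ℝ => 1 / (2 * τ)) =O[atTop] fun τ => τ⁻¹ := by
      refine ((isBigO_refl (fun τ : ℝ => τ⁻¹) atTop).const_mul_left (1 / 2)).congr_left
        fun τ => by rw [one_div, one_div, mul_inv 2]
    refine ((hμ.mul hμ).mul (e3.mul
      ((isBigO_integral_mul_endPotential hf hp hq).neg_left.add e2))).congr' .rfl ?_
    filter_upwards [eventually_gt_atTop 0] with τ hτ
    rw [inv_mul_cancel₀ hτ.ne', mul_one, Real.rpow_add hτ]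
  refine (hasAsymptoticExpansion_reflectionCoeff hγ).of_remainder
    (δ := T - 2 * (a - b)) (by linarith) hO ?_
  filter_upwards [hS, eventually_gt_atTop 0, eventually_add_ne_zero (β := β) hγ] with τ hSτ hτ hne
  rw [normalized, obstacle, sourceB, setDist_Ioi_Icc (by linarith) (by linarith), sq_abs,
    backScattering_eq hba hε hf hp hq hτ hrep, echo_eq hε hba hsupp hτ hne hrep]
  simp only [hh]
  have x1 : Real.exp (-(T - 2 * (a - b)) * τ) =
      Real.exp (2 * τ * (a - b)) * Real.exp (-τ * T) := by
    rw [← Real.exp_add]; ring_nf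
  have x2 : Real.exp (2 * τ * (a - b)) * Real.exp (-τ * (a - b)) * Real.exp (-τ * (a - b)) = 1 := by
    rw [← Real.exp_add, ← Real.exp_add, Real.exp_eq_one_iff]; ring
  have hJτ : (∫ y in sourceB b ε, f y * endPotential a p q τ y) = J τ := rfl
  rw [x1, hJτ]
  generalize Real.exp (2 * τ * (a - b)) = E₁ at *
  generalize Real.exp (-τ * T) = E₃ at *
  generalize Real.exp (-τ * (a - b)) = E₅ at *
  generalize sourceIntegral b ε f τ = S at *
  generalize reflectionCoeff γ β τ = R at *
  generalize echoRemainder a T γ β u p q τ = m at *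
  have hR : R / (2 * τ) = R / (2 * τ) * (E₁ * E₅ * E₅) := by rw [x2, mul_one]
  rw [hR]
  field_simp
  ring

end Asymptotics

theorem theorem4p3 (a b ε T γ β : ℝ) (ha : 0 < a) (hb : b < 0) (hε : 0 < ε) (hT : 0 < T)
    (hγ : 0 ≤ γ) (f : ℝ → ℝ) (hf : MemLp f 2 volume)
    (hsupp : ∀ᵐ x, x ∉ sourceB b ε → f x = 0)
    (hnv : NonvanishingAtEndpoint b ε f)
    (u : ℝ → ℝ → ℝ) (hu : IsWeakSolution a T γ β f u) :
    (∀ τ : ℝ, 0 < τ →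
      (∀ x ≤ a, IntervalIntegrable (fun t => Real.exp (-τ * t) * u x t) volume 0 T) ∧
      DifferentiableAt ℝ (fun x => waveLaplace T u x τ) 0 ∧
      DifferentiableAt ℝ (fun x => freeField f x τ) 0 ∧
      IntegrableOn (fun y => f y * (waveLaplace T u y τ - freeField f y τ)) (sourceB b ε)) ∧
    (2 * setDist (obstacle a) (sourceB b ε) - setDist domainOmega (sourceB b ε) < T →
      HasAsymptoticExpansion (normalized a b ε f (indicatorI T f u)) (expansionCoeff γ β) ∧
      RecoversParameters (normalized a b ε f (indicatorI T f u)) γ β) ∧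
    (2 * setDist (obstacle a) (sourceB b ε) < T →
      HasAsymptoticExpansion (normalized a b ε f (backScattering b ε T f u))
        (expansionCoeff γ β) ∧
      RecoversParameters (normalized a b ε f (backScattering b ε T f u)) γ β) := by
  have hba : b < a := hb.trans ha
  obtain ⟨p, q, hp, hq, hrep⟩ := hu.exists_hasEchoRepresentation hba hsupp hT
  have hdist : setDist (obstacle a) (sourceB b ε) = a - b :=
    setDist_Ioi_Icc (by linarith) hba
  have hdist' : setDist domainOmega (sourceB b ε) = 0 - b :=
    setDist_Ioi_Icc (by linarith) hb
  refine ⟨fun τ hτ => ⟨fun x hx => ?_, ?_, ?_, ?_⟩, fun hT' => ?_, fun hT' => ?_⟩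
  · refine ContinuousOn.intervalIntegrable ?_
    rw [uIcc_of_le hT.le]
    exact (Continuous.continuousOn (by fun_prop)).mul ((hu.exists_waveLaplace_eq hT).1 x hx)
  · exact (hasDerivAt_waveLaplace ha hε hb hsupp hp hq hτ hrep).differentiableAt
  · exact (hasDerivAt_freeField hε hsupp hb hτ).differentiableAt
  · exact integrableOn_mul_sub hba hf hp hq hτ hrep
  · rw [hdist, hdist'] at hT'
    have h := hasAsymptoticExpansion_indicatorI ha hb hε hγ hsupp hnv hp hq hrep (by linarith)
    exact ⟨h, h.recoversParameters hγ⟩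
  · rw [hdist] at hT'
    have h := hasAsymptoticExpansion_backScattering hba hε hγ hf hsupp hnv hp hq hrep hT'
    exact ⟨h, h.recoversParameters hγ⟩
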